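/- **EXIT thresholds.** For $s\ge 0$ let $J(s)=1-\mathbb{E}\left[\log_2(1+e^{-L})\right]$ with $L\sim\mathcal{N}(s^2/2,s^2)$, the mutual information between an equiprobable binary input and a consistent Gaussian log-likelihood ratio of variance $s^2$. Extend $J$ by $J(\infty)=1$, and let $J^{-1}\colon[0,1]\to[0,\infty]$ be its inverse. Let $\mathbf{B}$ be a binary proto-matrix (rows are check nodes, columns are variable nodes, and there is an edge $(i,j)$ iff $b_{i,j}=1$), and let $\sigma>0$. Put $w^{(0)}_{i,j}=0$ and, for $\ell\ge 0$ and every edge $(i,j)$, $$y^{(\ell)}_{i,j}=J\left(\sqrt{\sum_{i'\ne i,\ b_{i',j}=1}J^{-1}\left(w^{(\ell)}_{i',j}\right)^2+\frac{4}{\sigma^2}}\right),\qquad w^{(\ell+1)}_{i,j}=1-J\left(\sqrt{\sum_{j'\ne j,\ b_{i,j'}=1}J^{-1}\left(1-y^{(\ell)}_{i,j'}\right)^2}\right).$$ The EXIT threshold $\sigma^*(\mathbf{B})\in[0,\infty]$ is the supremum of all $\sigma>0$ such that $y^{(\ell)}_{i,j}\to 1$ as $\ell\to\infty$ for every edge $(i,j)$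 (with $\sup\emptyset=0$). **Constructions.** Let $\mathbf{1}_{\alpha\times\beta}$ be the all-one $\alpha\times\beta$ matrix, let $\mathbf{Q}(\alpha,\beta;k)$ be the $\alpha\times\beta$ matrix whose $k$-th row is zero and whose other entries are $1$, and let $\mathbf{S}(\alpha,\beta)$ be the $\alpha\times\beta$ matrix with zeros at the positions $(i,i)$, $i\le\min(\alpha,\beta)$, and ones elsewhere. For positive integers $\gamma_l,\kappa,\nu$ with $\nu<\kappa$ write $\nu=a\gamma_l+b$ with integers $a\ge 0$ and $0\le b<\gamma_l$, and define the balanced and unbalanced $\gamma_l\times\kappa$ proto-matrices $$\mathbf{B}_B=\left[\mathbf{1}_{\gamma_l\times(\kappa-\nu)}\mid\mathbf{S}(\gamma_l,b)\mid\mathbf{Q}(\gamma_l,a;\gamma_l)\mid\cdots\mid\mathbf{Q}(\gamma_l,a;1)\right],\qquad \mathbf{B}_U=\left[\mathbf{1}_{\gamma_l\times(\kappa-\nu)}\mid\mathbf{Q}(\gamma_l,\nu;1)\right],$$ each with exactly $\nu$ zeros. **Proposition.** Let $\kappa$, $\gamma_l$ and $\nu<\kappa$ be positive integers. If $\kappa-\lfloor\nu/\gamma_l\rfloor\le\nu$,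 then $\sigma^*(\mathbf{B}_U)\le\sigma^*(\mathbf{B}_B)$. -/

import Mathlib

open Filter Topology MeasureTheory ProbabilityTheory
open scoped ENNReal NNReal

/-! ### EXIT analysis of protographs over the binary-input AWGN channel -/

noncomputable section

namespace EXIT

/-- The function `J : [0,∞) → [0,1)`: the mutual information, in bits, between an equiprobable
binary input `X ∈ {-1, 1}` and a consistent Gaussian log-likelihood ratio of mean `X * s ^ 2 / 2`
and variance `s ^ 2`, namely
`J(s) = 1 - E[log₂ (1 + exp (-L))]` with `L ∼ N(s ^ 2 / 2, s ^ 2)`. -/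
def J₀ (s : ℝ≥0) : ℝ :=
  1 - ∫ x, Real.logb 2 (1 + Real.exp (-x)) ∂(gaussianReal ((s : ℝ) ^ 2 / 2) (s ^ 2))

/-- `J` extended to `[0,∞]` by its limit `J(∞) = 1`. The extension is needed because the
message sent by a check node of degree one is exactly `1`. -/
def J (s : ℝ≥0∞) : ℝ := if s = ∞ then 1 else J₀ s.toNNReal

/-- The inverse `J⁻¹ : [0,1] → [0,∞]` of the continuous increasing bijection `J`. -/
def Jinv (y : ℝ) : ℝ≥0∞ := sInf {s : ℝ≥0∞ | y ≤ J s}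

/-- Output of a variable node with channel parameter `sch` and incoming values `m i`, `i ∈ S`:
`J (√(∑ (J⁻¹ (m i))² + sch²))`. -/
def outV {ι : Type*} (sch : ℝ≥0∞) (S : Finset ι) (m : ι → ℝ) : ℝ :=
  J ((∑ i ∈ S, Jinv (m i) ^ 2 + sch ^ 2) ^ (1 / 2 : ℝ))

/-- Output of a check node with incoming values `m j`, `j ∈ S`. -/
def outC {ι : Type*} (S : Finset ι) (m : ι → ℝ) : ℝ :=
  1 - outV 0 S (fun j => 1 - m j)

section Protograph

variable {R C : Type*} [Fintype R] [DecidableEq R] [Fintype C] [DecidableEq C]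

/-- One round of variable-to-check updates for the proto-matrix `B` (check nodes `R`, variable
nodes `C`, an edge at `(i, j)` iff `B i j = 1`) at channel parameter `σ`, where `s_ch = 2 / σ`. -/
def stepV (B : Matrix R C ℕ) (σ : ℝ) (w : R → C → ℝ) (i : R) (j : C) : ℝ :=
  outV (ENNReal.ofReal (2 / σ)) {i' : R | i' ≠ i ∧ B i' j = 1} (fun i' => w i' j)

/-- One round of check-to-variable updates. -/
def stepC (B : Matrix R C ℕ) (y : R → C → ℝ) (i : R) (j : C) : ℝ :=
  outC {j' : C | j' ≠ j ∧ B i j' = 1} (fun j' => y i j')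

/-- The check-to-variable EXIT values entering iteration `ℓ`, initially `0`; only the values at
positions that are edges matter. -/
def cnToVn (B : Matrix R C ℕ) (σ : ℝ) : ℕ → R → C → ℝ
  | 0 => fun _ _ => 0
  | ℓ + 1 => stepC B (stepV B σ (cnToVn B σ ℓ))

/-- The variable-to-check EXIT values of iteration `ℓ`. -/
def vnToCn (B : Matrix R C ℕ) (σ : ℝ) (ℓ : ℕ) : R → C → ℝ :=
  stepV B σ (cnToVn B σ ℓ)

/-- At channel parameter `σ`, the EXIT values sent by the variable nodes approach `1` on every
edge. -/
def Converges (B : Matrix R C ℕ) (σ : ℝ) : Prop :=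
  ∀ i j, B i j = 1 → Tendsto (fun ℓ => vnToCn B σ ℓ i j) atTop (𝓝 1)

/-- The EXIT threshold `σ*(B) ∈ [0,∞]`: the supremum of the channel parameters `σ > 0` at which
the EXIT values approach `1` (`0` if there are none, `∞` if they are unbounded). -/
def threshold (B : Matrix R C ℕ) : ℝ≥0∞ :=
  sSup (ENNReal.ofReal '' {σ : ℝ | 0 < σ ∧ Converges B σ})

end Protograph

end EXIT

/-! ### The balanced and unbalanced local-code proto-matrices -/

namespace LocalCode

/-- The all-one matrix. -/
def ones (α β : ℕ) : Matrix (Fin α) (Fin β) ℕ := fun _ _ => 1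

/-- `Q(α, β; k)`: all ones except for row `k`, which is zero; rows are numbered from `1`. -/
def Q (α β k : ℕ) : Matrix (Fin α) (Fin β) ℕ := fun i _ => if (i : ℕ) + 1 = k then 0 else 1

/-- `S(α, β)`: zeros on the main diagonal, ones elsewhere. -/
def S (α β : ℕ) : Matrix (Fin α) (Fin β) ℕ := fun i j => if (j : ℕ) = (i : ℕ) then 0 else 1

/-- The concatenation `[Q(γ, a; γ) | Q(γ, a; γ - 1) | ⋯ | Q(γ, a; 1)]`; the column `(p, c)` is
column `c` of block number `p`, blocks being numbered from `0`. -/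
def Qblocks (γ a : ℕ) : Matrix (Fin γ) (Fin γ × Fin a) ℕ := fun i pc => Q γ a (γ - pc.1) i pc.2

/-- `B_B = [1 | S(γ, b) | Q(γ, a; γ) | ⋯ | Q(γ, a; 1)]` with `ν = a γ + b`, `0 ≤ b < γ`. -/
def balanced (γ κ ν : ℕ) :
    Matrix (Fin γ) (Fin (κ - ν) ⊕ (Fin (ν % γ) ⊕ (Fin γ × Fin (ν / γ)))) ℕ :=
  Matrix.fromCols (ones γ (κ - ν)) (Matrix.fromCols (S γ (ν % γ)) (Qblocks γ (ν / γ)))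

/-- `B_U = [1 | Q(γ, ν; 1)]`. -/
def unbalanced (γ κ ν : ℕ) : Matrix (Fin γ) (Fin (κ - ν) ⊕ Fin ν) ℕ :=
  Matrix.fromCols (ones γ (κ - ν)) (Q γ ν 1)

end LocalCode

end

/-!
Suppose that the recursion for the unbalanced matrix converges at `σ`. Its `ν` right-hand columns
carry an all-one `(γ - 1) × ν` submatrix, and variable nodes there have no further edges. Deleting
the other columns only removes nonnegative terms from the check node sums, so it only improves the
messages. Hence the scalar recursion of the `(γ - 1, ν)`-regular ensemble dominates the messages on
these columns (`vnToCn_le_regularV`) and converges to `1` as well.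

In the balanced matrix every column has at most one zero and every row has at least `⌊ν / γ⌋`
zeros, so variable nodes have degree at least `γ - 1` and check nodes have degree at most
`κ - ⌊ν / γ⌋ ≤ ν`. Its messages therefore dominate those of the same regular ensemble
(`regularV_le_vnToCn`), and they are at most `1`.

Both comparisons need that `J` is monotone (`J_mono`). With `L_t ∼ N(t / 2, t)`, the variable
`exp (-L_t)` is a mean-one exponential martingale in `t`, since `L_{t + r}` is `L_t` plus an
independent copy of `L_r`; as `x ↦ log (1 + x)` is concave, `E[log (1 + exp (-L_t))]` decreases
in `t`.

If `γ = 1`, variable nodes receive nothing but the channel value, and all messages of both matrices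
are equal.
-/

namespace EXIT

/-! ### Monotonicity of `J` -/

lemma integrable_exp_neg_gaussianReal (μ : ℝ) (v : ℝ≥0) :
    Integrable (fun x => Real.exp (-x)) (gaussianReal μ v) := by
  simpa using integrable_exp_mul_gaussianReal (μ := μ) (v := v) (-1)

lemma integral_exp_neg_gaussianReal (v : ℝ≥0) :
    ∫ x, Real.exp (-x) ∂(gaussianReal ((v : ℝ) / 2) v) = 1 := by
  have h := congrFun (mgf_id_gaussianReal (μ := (v : ℝ) / 2) (v := v)) (-1)
  simp only [mgf, id, neg_mul, one_mul] at h
  rw [h, Real.exp_eq_one_iff]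
  ring

lemma log_one_add_exp_neg_nonneg (x : ℝ) : 0 ≤ Real.log (1 + Real.exp (-x)) :=
  Real.log_nonneg (by linarith [Real.exp_pos (-x)])

lemma integrable_log_one_add_exp_neg (μ : ℝ) (v : ℝ≥0) :
    Integrable (fun x => Real.log (1 + Real.exp (-x))) (gaussianReal μ v) := by
  refine (integrable_exp_neg_gaussianReal μ v).mono'
    (Measurable.aestronglyMeasurable (by fun_prop)) (.of_forall fun x => ?_)
  rw [Real.norm_eq_abs, abs_of_nonneg (log_one_add_exp_neg_nonneg x)]
  linarith [Real.log_le_sub_one_of_pos (show 0 < 1 + Real.exp (-x) by positivity)]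

/-- The tangent of the concave function `z ↦ log (1 + exp (-x) * z)` at `z = 1`, evaluated at
`z = exp (-y)`. -/
lemma log_one_add_exp_neg_add_le (x y : ℝ) :
    Real.log (1 + Real.exp (-(x + y))) ≤ Real.log (1 + Real.exp (-x)) +
      Real.exp (-x) / (1 + Real.exp (-x)) * (Real.exp (-y) - 1) := by
  have hx : 0 < 1 + Real.exp (-x) := by positivity
  have hxy : 0 < 1 + Real.exp (-(x + y)) := by positivity
  have h := Real.log_le_sub_one_of_pos (div_pos hxy hx)
  rw [Real.log_div hxy.ne' hx.ne'] at h
  have e : (1 + Real.exp (-(x + y))) / (1 + Real.exp (-x)) - 1 =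
      Real.exp (-x) / (1 + Real.exp (-x)) * (Real.exp (-y) - 1) := by
    rw [neg_add, Real.exp_add]
    field_simp
    ring
  linarith

lemma integral_log_one_add_exp_neg_add_le (v : ℝ≥0) (x : ℝ) :
    ∫ y, Real.log (1 + Real.exp (-(x + y))) ∂(gaussianReal ((v : ℝ) / 2) v) ≤
      Real.log (1 + Real.exp (-x)) := by
  have hi : Integrable (fun y => Real.exp (-y) - 1) (gaussianReal ((v : ℝ) / 2) v) :=
    (integrable_exp_neg_gaussianReal _ _).sub (integrable_const _)
  have hi' := hi.const_mul (Real.exp (-x) / (1 + Real.exp (-x)))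
  calc _ ≤ ∫ y, (Real.log (1 + Real.exp (-x)) +
        Real.exp (-x) / (1 + Real.exp (-x)) * (Real.exp (-y) - 1))
          ∂(gaussianReal ((v : ℝ) / 2) v) := by
        refine integral_mono_of_nonneg (.of_forall fun y => log_one_add_exp_neg_nonneg _)
          ((integrable_const _).add hi') (.of_forall fun y => log_one_add_exp_neg_add_le x y)
    _ = _ := by
        have h0 : ∫ y, (Real.exp (-y) - 1) ∂(gaussianReal ((v : ℝ) / 2) v) = 0 := by
          rw [integral_sub (integrable_exp_neg_gaussianReal _ _) (integrable_const _),
            integral_exp_neg_gaussianReal]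
          simp
        rw [integral_add (integrable_const _) hi', integral_const_mul, h0]
        simp

lemma integral_log_one_add_exp_neg_antitone :
    Antitone fun v : ℝ≥0 =>
      ∫ x, Real.log (1 + Real.exp (-x)) ∂(gaussianReal ((v : ℝ) / 2) v) := by
  intro v w hvw
  obtain ⟨r, rfl⟩ := exists_add_of_le hvw
  have hconv : gaussianReal (((v + r : ℝ≥0) : ℝ) / 2) (v + r) =
      (gaussianReal ((v : ℝ) / 2) v).conv (gaussianReal ((r : ℝ) / 2) r) := by
    rw [gaussianReal_conv_gaussianReal]
    congr 1
    push_cast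
    ring
  have hint := integrable_log_one_add_exp_neg (((v + r : ℝ≥0) : ℝ) / 2) (v + r)
  dsimp only
  rw [hconv] at hint ⊢
  rw [integral_conv hint]
  exact integral_mono_of_nonneg
    (.of_forall fun x => integral_nonneg fun y => log_one_add_exp_neg_nonneg _)
    (integrable_log_one_add_exp_neg _ _)
    (.of_forall fun x => integral_log_one_add_exp_neg_add_le r x)

lemma J₀_eq (s : ℝ≥0) :
    J₀ s = 1 - (∫ x, Real.log (1 + Real.exp (-x))
      ∂(gaussianReal (((s ^ 2 : ℝ≥0) : ℝ) / 2) (s ^ 2))) / Real.log 2 := by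
  simp only [J₀, Real.logb, integral_div, NNReal.coe_pow]

lemma J₀_mono : Monotone J₀ := by
  intro s t hst
  rw [J₀_eq, J₀_eq]
  have h := integral_log_one_add_exp_neg_antitone (pow_le_pow_left₀ zero_le hst 2)
  gcongr

lemma J_le_one (s : ℝ≥0∞) : J s ≤ 1 := by
  unfold J
  split_ifs
  · exact le_rfl
  · rw [J₀_eq]
    have : 0 ≤ (∫ x, Real.log (1 + Real.exp (-x))
        ∂(gaussianReal (((s.toNNReal ^ 2 : ℝ≥0) : ℝ) / 2) (s.toNNReal ^ 2))) / Real.log 2 :=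
      div_nonneg (integral_nonneg log_one_add_exp_neg_nonneg) (Real.log_nonneg (by norm_num))
    linarith

lemma J_mono : Monotone J := by
  intro s t hst
  by_cases ht : t = ∞
  · simpa [ht, J] using J_le_one s
  · have hs : s ≠ ∞ := ne_top_of_le_ne_top ht hst
    simpa [J, hs, ht] using J₀_mono (ENNReal.toNNReal_mono ht hst)

lemma Jinv_mono : Monotone Jinv := fun _ _ h => sInf_le_sInf fun _ hs => h.trans hs

/-! ### Comparison of node outputs -/

lemma outV_le_outV {ι κ : Type*} (sch : ℝ≥0∞) {S : Finset ι} {T : Finset κ} {m : ι → ℝ}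
    {m' : κ → ℝ} (hST : S.card ≤ T.card) (h : ∀ i ∈ S, ∀ j ∈ T, m i ≤ m' j) :
    outV sch S m ≤ outV sch T m' := by
  obtain ⟨f⟩ : Nonempty (S ↪ T) :=
    Function.Embedding.nonempty_of_card_le (by simpa using hST)
  refine J_mono (ENNReal.rpow_le_rpow (add_le_add_left ?_ _) (by norm_num))
  calc ∑ i ∈ S, Jinv (m i) ^ 2 = ∑ i : S, Jinv (m i) ^ 2 := (Finset.sum_coe_sort S _).symm
    _ ≤ ∑ i : S, Jinv (m' (f i)) ^ 2 := Finset.sum_le_sum fun i _ =>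
        pow_le_pow_left' (Jinv_mono (h i i.2 (f i) (f i).2)) 2
    _ = ∑ j ∈ Finset.univ.map f, Jinv (m' j) ^ 2 :=
        (Finset.sum_map Finset.univ f fun j => Jinv (m' j) ^ 2).symm
    _ ≤ ∑ j : T, Jinv (m' j) ^ 2 := Finset.sum_le_sum_of_subset (Finset.subset_univ _)
    _ = ∑ j ∈ T, Jinv (m' j) ^ 2 := Finset.sum_coe_sort T fun j => Jinv (m' j) ^ 2

lemma outC_le_outC {ι κ : Type*} {S : Finset ι} {T : Finset κ} {m : ι → ℝ}
    {m' : κ → ℝ} (hTS : T.card ≤ S.card) (h : ∀ i ∈ S, ∀ j ∈ T, m i ≤ m' j) :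
    outC S m ≤ outC T m' :=
  sub_le_sub_left
    (outV_le_outV 0 hTS fun j hj i hi => sub_le_sub_left (h i hi j hj) 1) 1

lemma outC_le_outC_of_subset {ι : Type*} {S T : Finset ι} (hTS : T ⊆ S) (m : ι → ℝ) :
    outC S m ≤ outC T m :=
  sub_le_sub_left (J_mono (ENNReal.rpow_le_rpow
    (add_le_add_left (Finset.sum_le_sum_of_subset hTS) _) (by norm_num))) 1

/-! ### Comparison with a regular ensemble -/

/-- The check-to-variable values entering iteration `ℓ` for the regular ensemble in which every
variable node output has `dv` incoming check node values and every check node output has `dc`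
incoming variable node values; the node degrees are thus `dv + 1` and `dc + 1`. -/
noncomputable def regularC (dv dc : ℕ) (σ : ℝ) : ℕ → ℝ
  | 0 => 0
  | ℓ + 1 => outC (Finset.range dc) fun _ =>
      outV (ENNReal.ofReal (2 / σ)) (Finset.range dv) fun _ => regularC dv dc σ ℓ

/-- The variable-to-check values of iteration `ℓ` for the regular ensemble of `regularC`. -/
noncomputable def regularV (dv dc : ℕ) (σ : ℝ) (ℓ : ℕ) : ℝ :=
  outV (ENNReal.ofReal (2 / σ)) (Finset.range dv) fun _ => regularC dv dc σ ℓ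

section Comparison

variable {R C : Type*} [Fintype R] [DecidableEq R] [Fintype C] [DecidableEq C]

lemma regularV_le_vnToCn {B : Matrix R C ℕ} {dv dc : ℕ}
    (hdv : ∀ i j, B i j = 1 → dv ≤ ({i' : R | i' ≠ i ∧ B i' j = 1} : Finset R).card)
    (hdc : ∀ i j, B i j = 1 → ({j' : C | j' ≠ j ∧ B i j' = 1} : Finset C).card ≤ dc)
    (σ : ℝ) (ℓ : ℕ) {i : R} {j : C} (hij : B i j = 1) :
    regularV dv dc σ ℓ ≤ vnToCn B σ ℓ i j := by
  have hV (ℓ) (hC : ∀ i j, B i j = 1 → regularC dv dc σ ℓ ≤ cnToVn B σ ℓ i j) (i j)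
      (hij : B i j = 1) : regularV dv dc σ ℓ ≤ vnToCn B σ ℓ i j :=
    outV_le_outV _ (by simpa using hdv i j hij)
      fun _ _ i' hi' => hC i' j (Finset.mem_filter.1 hi').2.2
  have hC : ∀ ℓ i j, B i j = 1 → regularC dv dc σ ℓ ≤ cnToVn B σ ℓ i j := by
    intro ℓ
    induction ℓ with
    | zero => exact fun _ _ _ => le_rfl
    | succ ℓ ih =>
      exact fun i j hij => outC_le_outC (by simpa using hdc i j hij)
        fun _ _ j' hj' => hV ℓ ih i j' (Finset.mem_filter.1 hj').2.2
  exact hV ℓ (hC ℓ) i j hij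

/-- The messages on a set `D` of columns are dominated by a regular ensemble. Only the edges inside
`D` count towards the check node degrees, because the remaining terms of a check node sum can only
lower its output. -/
lemma vnToCn_le_regularV {B : Matrix R C ℕ} {dv dc : ℕ} (D : Finset C)
    (hdv : ∀ i, ∀ j ∈ D, B i j = 1 →
      ({i' : R | i' ≠ i ∧ B i' j = 1} : Finset R).card ≤ dv)
    (hdc : ∀ i, ∀ j ∈ D, B i j = 1 → dc ≤ (D.filter fun j' => j' ≠ j ∧ B i j' = 1).card)
    (σ : ℝ) (ℓ : ℕ) {i : R} {j : C} (hj : j ∈ D) (hij : B i j = 1) :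
    vnToCn B σ ℓ i j ≤ regularV dv dc σ ℓ := by
  have hV (ℓ) (hC : ∀ i, ∀ j ∈ D, B i j = 1 → cnToVn B σ ℓ i j ≤ regularC dv dc σ ℓ) (i)
      (j) (hj : j ∈ D) (hij : B i j = 1) : vnToCn B σ ℓ i j ≤ regularV dv dc σ ℓ :=
    outV_le_outV _ (by simpa using hdv i j hj hij)
      fun i' hi' _ _ => hC i' j hj (Finset.mem_filter.1 hi').2.2
  have hC : ∀ ℓ i, ∀ j ∈ D, B i j = 1 → cnToVn B σ ℓ i j ≤ regularC dv dc σ ℓ := by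
    intro ℓ
    induction ℓ with
    | zero => exact fun _ _ _ _ => le_rfl
    | succ ℓ ih =>
      intro i j hj hij
      refine (outC_le_outC_of_subset (Finset.filter_subset_filter _ (Finset.subset_univ D))
        _).trans (outC_le_outC (by simpa using hdc i j hj hij) fun j' hj' _ _ => ?_)
      rw [Finset.mem_filter] at hj'
      exact hV ℓ ih i j' hj'.1 hj'.2.2
  exact hV ℓ (hC ℓ) i j hj hij

lemma vnToCn_of_subsingleton [Subsingleton R] (B : Matrix R C ℕ) (σ : ℝ) (ℓ : ℕ) (i : R) (j : C) :
    vnToCn B σ ℓ i j = J ((ENNReal.ofReal (2 / σ) ^ 2) ^ (1 / 2 : ℝ)) := by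
  have h : ({i' : R | i' ≠ i ∧ B i' j = 1} : Finset R) = ∅ :=
    Finset.filter_eq_empty_iff.2 fun i' _ hi' => hi'.1 (Subsingleton.elim _ _)
  rw [vnToCn, stepV, h, outV, Finset.sum_empty, zero_add]

lemma threshold_le_threshold {R' C' : Type*} [Fintype R'] [DecidableEq R'] [Fintype C']
    [DecidableEq C'] {B : Matrix R C ℕ} {B' : Matrix R' C' ℕ}
    (h : ∀ σ, Converges B σ → Converges B' σ) : threshold B ≤ threshold B' :=
  sSup_le_sSup (Set.image_mono fun σ hσ => ⟨hσ.1, h σ hσ.2⟩)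

end Comparison

end EXIT

namespace LocalCode

/-! ### Node degrees of the two proto-matrices -/

lemma balanced_column_degree (γ κ ν : ℕ) (i : Fin γ)
    (j : Fin (κ - ν) ⊕ (Fin (ν % γ) ⊕ (Fin γ × Fin (ν / γ)))) :
    γ - 2 ≤ ({i' : Fin γ | i' ≠ i ∧ balanced γ κ ν i' j = 1} : Finset (Fin γ)).card := by
  obtain ⟨z, hz⟩ : ∃ z : Fin γ, ∀ i', i' ≠ z → balanced γ κ ν i' j = 1 := by
    rcases j with j | j | ⟨p, c⟩
    · exact ⟨i, fun _ _ => rfl⟩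
    · refine ⟨⟨j, j.2.trans (Nat.mod_lt _ i.pos)⟩, fun i' hi' => if_neg fun e => hi' ?_⟩
      exact Fin.ext e.symm
    · refine ⟨p.rev, fun i' hi' => if_neg fun e => hi' (Fin.ext ?_)⟩
      have := p.2
      simp only [Fin.val_rev] at e ⊢
      omega
  calc γ - 2 ≤ (Finset.univ \ {i, z} : Finset (Fin γ)).card := by
        have h1 := Finset.le_card_sdiff {i, z} (Finset.univ : Finset (Fin γ))
        have h2 := Finset.card_le_two (a := i) (b := z)
        rw [Finset.card_univ, Fintype.card_fin] at h1
        omega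
    _ ≤ _ := by
        refine Finset.card_le_card fun i' hi' => ?_
        simp only [Finset.mem_sdiff, Finset.mem_insert, Finset.mem_singleton, not_or] at hi'
        simpa using ⟨hi'.2.1, hz i' hi'.2.2⟩

lemma balanced_row_degree {γ κ ν : ℕ} (hνκ : ν < κ) {i : Fin γ}
    {j : Fin (κ - ν) ⊕ (Fin (ν % γ) ⊕ (Fin γ × Fin (ν / γ)))}
    (hij : balanced γ κ ν i j = 1) :
    (Finset.univ.filter fun j' => j' ≠ j ∧ balanced γ κ ν i j' = 1).card ≤
      κ - ν / γ - 1 := by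
  let f : Fin (ν / γ) ↪ Fin (κ - ν) ⊕ (Fin (ν % γ) ⊕ (Fin γ × Fin (ν / γ))) :=
    ⟨fun c => .inr (.inr (i.rev, c)), fun c c' h => by simpa using h⟩
  have hf (c) : balanced γ κ ν i (f c) = 0 := by
    refine if_pos ?_
    rw [Fin.val_rev]
    omega
  have hj : j ∉ Finset.univ.map f := by
    rw [Finset.mem_map]
    rintro ⟨c, -, rfl⟩
    simp [hf] at hij
  calc _ ≤ (Finset.univ \ Finset.cons j (Finset.univ.map f) hj).card := by
        refine Finset.card_le_card fun j' hj' => ?_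
        simp only [Finset.mem_filter, Finset.mem_univ, true_and] at hj'
        simp only [Finset.mem_sdiff, Finset.mem_univ, true_and, Finset.mem_cons, not_or,
          Finset.mem_map, not_exists]
        refine ⟨hj'.1, fun c hc => ?_⟩
        have := hf c
        rw [hc, hj'.2] at this
        exact one_ne_zero this
    _ = κ - ν / γ - 1 := by
        rw [Finset.card_sdiff_of_subset (Finset.subset_univ _), Finset.card_cons,
          Finset.card_map]
        simp only [Finset.card_univ, Fintype.card_sum, Fintype.card_prod, Fintype.card_fin]
        rw [Nat.mod_add_div]
        omega

lemma unbalanced_inr_eq_one {γ κ ν : ℕ} {i : Fin γ} {c : Fin ν} :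
    unbalanced γ κ ν i (.inr c) = 1 ↔ (i : ℕ) ≠ 0 := by
  simp [unbalanced, Q]

lemma unbalanced_column_degree {γ κ ν : ℕ} {i : Fin γ} {c : Fin ν} (hi : (i : ℕ) ≠ 0) :
    ({i' : Fin γ | i' ≠ i ∧ unbalanced γ κ ν i' (.inr c) = 1} : Finset (Fin γ)).card ≤
      γ - 2 := by
  let z : Fin γ := ⟨0, i.pos⟩
  have hiz : i ≠ z := fun e => hi (congrArg Fin.val e)
  calc _ ≤ (Finset.univ \ {i, z} : Finset (Fin γ)).card := by
        refine Finset.card_le_card fun i' hi' => ?_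
        simp only [Finset.mem_filter, Finset.mem_univ, true_and, unbalanced_inr_eq_one] at hi'
        simpa using ⟨hi'.1, fun e => hi'.2 (congrArg Fin.val e)⟩
    _ = γ - 2 := by
        rw [Finset.card_sdiff_of_subset (Finset.subset_univ _), Finset.card_pair hiz]
        simp

lemma unbalanced_row_degree {γ κ ν : ℕ} {i : Fin γ} {c : Fin ν} (hi : (i : ℕ) ≠ 0) :
    ν - 1 ≤ ((Finset.univ.map (Function.Embedding.inr (α := Fin (κ - ν)) (β := Fin ν))).filter
      fun j' => j' ≠ .inr c ∧ unbalanced γ κ ν i j' = 1).card := by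
  calc ν - 1 = ((Finset.univ.erase c).map
        (Function.Embedding.inr (α := Fin (κ - ν)) (β := Fin ν))).card := by
        simp
    _ ≤ _ := by
        refine Finset.card_le_card fun j' hj' => ?_
        obtain ⟨c', hc', rfl⟩ := Finset.mem_map.1 hj'
        simpa [unbalanced_inr_eq_one, hi] using hc'

end LocalCode

open EXIT LocalCode in
lemma converges_balanced_of_converges_unbalanced {κ γ ν : ℕ} (hγ : 0 < γ) (hν : 0 < ν)
    (hνκ : ν < κ) (h : κ - ν / γ ≤ ν) {σ : ℝ} (hU : Converges (unbalanced γ κ ν) σ) :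
    Converges (balanced γ κ ν) σ := by
  intro i j hij
  obtain rfl | hγ1 := Nat.eq_or_lt_of_le (Nat.succ_le_of_lt hγ)
  · have hU0 := hU 0 (.inl ⟨0, Nat.sub_pos_of_lt hνκ⟩) rfl
    simpa only [vnToCn_of_subsingleton] using hU0
  · have hi1 : (unbalanced γ κ ν) ⟨1, hγ1⟩ (.inr ⟨0, hν⟩) = 1 :=
      unbalanced_inr_eq_one.2 one_ne_zero
    refine tendsto_of_tendsto_of_tendsto_of_le_of_le (hU _ _ hi1) tendsto_const_nhds
      (fun ℓ => ?_) fun ℓ => J_le_one _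
    refine (vnToCn_le_regularV (dv := γ - 2) (dc := ν - 1) (Finset.univ.map .inr)
      ?_ ?_ σ ℓ (by simp) hi1).trans (regularV_le_vnToCn
        (fun i j _ => balanced_column_degree γ κ ν i j)
        (fun i j hij => (balanced_row_degree hνκ hij).trans (Nat.sub_le_sub_right h 1))
        σ ℓ hij)
    all_goals
      intro i j hj hij
      obtain ⟨c, -, rfl⟩ := Finset.mem_map.1 hj
      have hi := unbalanced_inr_eq_one.1 hij
    · exact unbalanced_column_degree hi
    · exact unbalanced_row_degree hi

theorem proposition3 (κ γ ν : ℕ) (hκ : 0 < κ) (hγ : 0 < γ) (hν : 0 < ν) (hνκ : ν < κ)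
    (h : κ - ν / γ ≤ ν) :
    EXIT.threshold (LocalCode.unbalanced γ κ ν) ≤ EXIT.threshold (LocalCode.balanced γ κ ν) :=
  EXIT.threshold_le_threshold fun _ =>
    converges_balanced_of_converges_unbalanced hγ hν hνκ h
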